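/- Theorem (Stein interpolation theorem). \label{stein} Let $(X,\mu)$ and $(Y,\nu)$ be $\sigma$-finite measure spaces and let $S=\{z\in\mathbb{C} : 0\le \operatorname{Re} z\le 1\}$. For each $z\in S$ let $T_z$ be a linear operator from the space of (complex-valued) simple functions in $L^1(X,\mu)$ into the space of complex-valued measurable functions on $Y$ (identified when equal $\nu$-almost everywhere). Suppose that the family $\{T_z\}_{z\in S}$ is admissible, that is, for all simple functions $f\in L^1(X,\mu)$ and $g\in L^1(Y,\nu)$: $(T_zf)g\in L^1(Y,\nu)$ for every $z\in S$; the map $z\mapsto \int_Y (T_zf)\,g\,d\nu$ is holomorphic in the interior of $S$ and continuous on $S$; and there is a constant $k<\pi$ (which may depend on $f$ and $g$) such that $$\sup_{z\in S} e^{-k|\operatorname{Im} z|}\left|\int_Y (T_zf)\,g\,d\nu\right|<\infty .$$ Fix $1\le p_0,p_1,q_0,q_1\le\infty$ and assume that for each real $y$ there are finite constants $M_0(y), M_1(y)\ge 0$ such that $$\|T_{iy}f\|_{q_0}\le M_0(y)\|f\|_{p_0}\quad\text{and}\quad \|T_{1+iy}f\|_{q_1}\le M_1(y)\|f\|_{p_1}$$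 for every simple function $f\in L^1(X,\mu)$, and that for some $k<\pi$ $$\sup_{-\infty<y<\infty} e^{-k|y|}\log M_j(y)<\infty\qquad (j=0,1).$$ Then for each $\theta\in[0,1]$ there is a finite constant $M_\theta$ such that $$\|T_\theta f\|_{q_\theta}\le M_\theta\|f\|_{p_\theta}$$ for every simple function $f\in L^1(X,\mu)$, where $$\frac1{p_\theta}=\frac{1-\theta}{p_0}+\frac{\theta}{p_1},\qquad \frac1{q_\theta}=\frac{1-\theta}{q_0}+\frac{\theta}{q_1}$$ (with $1/\infty=0$). -/

import Mathlib

open MeasureTheory Set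
open scoped NNReal ENNReal

/-- The complex vector space of (complex-valued) simple functions in `L¹(μ)`. -/
def integrableSimple {X : Type*} [MeasurableSpace X] (μ : Measure X) :
    Submodule ℂ (SimpleFunc X ℂ) where
  carrier := {f | Integrable (f : X → ℂ) μ}
  zero_mem' := by
    change Integrable ((0 : SimpleFunc X ℂ) : X → ℂ) μ
    rw [SimpleFunc.coe_zero]
    exact integrable_zero X ℂ μ
  add_mem' := by
    intro f g hf hg
    change Integrable ((f + g : SimpleFunc X ℂ) : X → ℂ) μ
    rw [SimpleFunc.coe_add]
    exact Integrable.add hf hg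
  smul_mem' := by
    intro c f hf
    change Integrable ((c • f : SimpleFunc X ℂ) : X → ℂ) μ
    rw [SimpleFunc.coe_smul]
    exact Integrable.smul c hf

/-- The closed strip `{z : 0 ≤ Re z ≤ 1}`. -/
def closedStrip : Set ℂ := {z | 0 ≤ z.re ∧ z.re ≤ 1}

/-- The pairing `∫ (T_z f) g dν`. -/
noncomputable def stripPairing {X Y : Type*} [MeasurableSpace X] [MeasurableSpace Y]
    {μ : Measure X} {ν : Measure Y}
    (T : ℂ → (integrableSimple μ →ₗ[ℂ] (Y →ₘ[ν] ℂ)))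
    (f : integrableSimple μ) (g : integrableSimple ν) (z : ℂ) : ℂ :=
  ∫ y, (T z f) y * g.1 y ∂ν

/-- Admissible families of linear operators, from the simple functions in `L¹(μ)` to the
(`ν`-classes of) measurable functions, indexed by the closed strip. Only the values `T z` with
`z` in the strip are constrained. -/
structure IsAdmissibleFamily {X Y : Type*} [MeasurableSpace X] [MeasurableSpace Y]
    {μ : Measure X} {ν : Measure Y}
    (T : ℂ → (integrableSimple μ →ₗ[ℂ] (Y →ₘ[ν] ℂ))) : Prop where
  integrable : ∀ z ∈ closedStrip, ∀ (f : integrableSimple μ) (g : integrableSimple ν),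
    Integrable (fun y => (T z f) y * g.1 y) ν
  differentiableOn : ∀ (f : integrableSimple μ) (g : integrableSimple ν),
    DifferentiableOn ℂ (stripPairing T f g) (interior closedStrip)
  continuousOn : ∀ (f : integrableSimple μ) (g : integrableSimple ν),
    ContinuousOn (stripPairing T f g) closedStrip
  growth : ∀ (f : integrableSimple μ) (g : integrableSimple ν), ∃ k : ℝ, k < Real.pi ∧
    BddAbove ((fun z : ℂ => Real.exp (-k * |z.im|) * ‖stripPairing T f g z‖) '' closedStrip)

/-!
The proof is complex interpolation in the strip. For `0 < θ < 1` and simple functions `f`, `g` of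
norm at most one in `L^p` and in the dual space `L^{q'}`, put `f_z = |f|^{γ(z)} f` and
`g_z = |g|^{δ(z)} g`, where `γ` and `δ` are affine, vanish at `θ`, and are chosen so that on the
line `Re z = j` the functions `f_z` and `g_z` have norm at most one in `L^{p_j}` and `L^{q_j'}`
(`eLpNorm_simplePower_le_one`). The function `F(z) = ∫ (T_z f_z) g_z` is a finite combination of
the pairings of level sets of `f` and `g`, with coefficients that are entire and bounded in the
strip, so it is holomorphic and of exponential growth
(`IsAdmissibleFamily.powerPairing_regularity`). Hölder's inequality bounds it by `M_j(y)` on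
`Re z = j`.

The bounds `M_j(y) ≤ exp (A e^{k|y|})` with `k < π` are absorbed by the holomorphic factor
`exp (-B cos (k (z - 1/2)))`: since
`Re cos (k (z - 1/2)) = cos (k (Re z - 1/2)) cosh (k Im z)` is positive on the strip, one choice of
`B` makes the product bounded by one on both lines, and the Phragmén–Lindelöf principle bounds
`F(θ) = ∫ (T_θ f) g` by a constant independent of `f` and `g`
(`norm_le_of_strip_of_boundary_exp_exp`). This replaces the Poisson integral of the strip, which
would give the optimal constant.

Finally, the norm of `T_θ f` is recovered from its pairings with simple functions
(`eLpNorm_le_of_forall_simple`). Testing against simple functions instead of against the extremal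
function of Hölder's inequality is allowed to cost a factor two, because only finiteness of the
constant matters; this makes all exponents, `q' = ∞` included, accessible to the same dominated
convergence argument.
-/

/-! ### A three lines theorem with doubly exponential boundary bounds -/

/-- If `F` is bounded by `exp (A e^{k|y|})` with `k < π` on the two boundary lines of the strip and
grows at most exponentially inside, then `F θ` is bounded in terms of `A` and `k` only. -/
theorem norm_le_of_strip_of_boundary_exp_exp {F : ℂ → ℂ} {A k C K : ℝ} (hk : 0 < k)
    (hkπ : k < Real.pi) (hA : 0 ≤ A)
    (hd : DifferentiableOn ℂ F (interior closedStrip)) (hc : ContinuousOn F closedStrip)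
    (hgrowth : ∀ z ∈ closedStrip, ‖F z‖ ≤ C * Real.exp (K * |z.im|))
    (h₀ : ∀ y : ℝ, ‖F (y * Complex.I)‖ ≤ Real.exp (A * Real.exp (k * |y|)))
    (h₁ : ∀ y : ℝ, ‖F (1 + y * Complex.I)‖ ≤ Real.exp (A * Real.exp (k * |y|)))
    {θ : ℝ} (hθ : θ ∈ Icc (0 : ℝ) 1) :
    ‖F θ‖ ≤ Real.exp (2 * A / Real.cos (k / 2)) := by
  have hcos : 0 < Real.cos (k / 2) := Real.cos_pos_of_mem_Ioo ⟨by linarith, by linarith⟩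
  set B : ℝ := 2 * A / Real.cos (k / 2) with hB
  have hB0 : 0 ≤ B := by positivity
  have hstrip : closedStrip = Complex.re ⁻¹' Icc 0 1 := rfl
  have hint : interior closedStrip = Complex.re ⁻¹' Ioo 0 1 := by
    rw [hstrip, Complex.interior_preimage_re, interior_Icc]
  have hclos : closure (Complex.re ⁻¹' Ioo (0 : ℝ) 1) = closedStrip := by
    rw [Complex.closure_preimage_re, closure_Ioo (by norm_num), hstrip]
  set w : ℂ → ℂ := fun z => Complex.exp (-(B * Complex.cos (k * (z - 1 / 2)))) with hw
  have hre : ∀ z : ℂ, (Complex.cos (k * (z - 1 / 2))).re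
      = Real.cos (k * (z.re - 1 / 2)) * Real.cosh (k * z.im) := by
    intro z
    have : (k : ℂ) * (z - 1 / 2) = ((k * (z.re - 1 / 2) : ℝ) : ℂ)
        + ((k * z.im : ℝ) : ℂ) * Complex.I := by
      apply Complex.ext <;> simp
    rw [this, Complex.cos_add_mul_I, ← Complex.ofReal_cos, ← Complex.ofReal_cosh,
      ← Complex.ofReal_sin, ← Complex.ofReal_sinh, ← Complex.ofReal_mul, ← Complex.ofReal_mul]
    simp only [Complex.sub_re, Complex.ofReal_re, Complex.re_ofReal_mul, Complex.I_re, mul_zero,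
      sub_zero]
  have hnorm : ∀ z : ℂ, ‖w z‖
      = Real.exp (-(B * (Real.cos (k * (z.re - 1 / 2)) * Real.cosh (k * z.im)))) := by
    intro z
    rw [hw, Complex.norm_exp, Complex.neg_re, Complex.re_ofReal_mul, hre]
  have hwle : ∀ z ∈ closedStrip, ‖w z‖ ≤ 1 := by
    rintro z ⟨h0, h1⟩
    rw [hnorm, Real.exp_le_one_iff, neg_nonpos]
    have : 0 ≤ Real.cos (k * (z.re - 1 / 2)) :=
      Real.cos_nonneg_of_mem_Icc ⟨by nlinarith, by nlinarith⟩
    have := Real.cosh_pos (k * z.im)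
    positivity
  -- on both lines `cos (k * (z.re - 1 / 2)) = cos (k / 2)`, and `e^{k|y|} ≤ 2 cosh (k y)`;
  -- this is what the value of `B` is chosen for
  have hbd : ∀ z : ℂ, Real.cos (k * (z.re - 1 / 2)) = Real.cos (k / 2) →
      ‖F z‖ ≤ Real.exp (A * Real.exp (k * |z.im|)) → ‖F z * w z‖ ≤ 1 := by
    intro z hz hF
    have hch : Real.exp (k * |z.im|) ≤ 2 * Real.cosh (k * z.im) := by
      rw [← Real.cosh_abs, abs_mul, abs_of_pos hk, Real.cosh_eq]
      linarith [Real.exp_pos (-(k * |z.im|))]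
    calc ‖F z * w z‖ = ‖F z‖ * ‖w z‖ := norm_mul _ _
      _ ≤ Real.exp (A * Real.exp (k * |z.im|))
          * Real.exp (-(A * (2 * Real.cosh (k * z.im)))) := by
        refine mul_le_mul hF (le_of_eq ?_) (norm_nonneg _) (Real.exp_nonneg _)
        rw [hnorm, hz, hB]
        congr 1
        field_simp
      _ ≤ 1 := by
        rw [← Real.exp_add, Real.exp_le_one_iff]
        nlinarith [mul_le_mul_of_nonneg_left hch hA]
  have hwd : Differentiable ℂ w := by
    rw [hw]; fun_prop
  -- the factor `w` is bounded, so the product still grows at most exponentially in the strip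
  have key : ‖F θ * w θ‖ ≤ 1 := by
    refine PhragmenLindelof.vertical_strip (f := fun z => F z * w z) (a := 0) (b := 1)
      ⟨?_, ?_⟩ ⟨1, by linarith [Real.pi_gt_three], |K|, ?_⟩ ?_ ?_ ?_ ?_
    · exact (hint ▸ hd).mul hwd.differentiableOn
    · rw [hclos]
      exact hc.mul hwd.continuous.continuousOn
    · refine Asymptotics.IsBigO.of_bound |C| ?_
      refine Filter.eventually_inf_principal.2 (Filter.Eventually.of_forall fun z hz => ?_)
      have hz' : z ∈ closedStrip := ⟨hz.1.le, hz.2.le⟩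
      have hK : K * |z.im| ≤ |K| * Real.exp (1 * |z.im|) := by
        have := Real.add_one_le_exp (1 * |z.im|)
        calc K * |z.im| ≤ |K| * |z.im| := by gcongr; exact le_abs_self K
          _ ≤ |K| * Real.exp (1 * |z.im|) := by gcongr; linarith
      calc ‖F z * w z‖ = ‖F z‖ * ‖w z‖ := norm_mul _ _
        _ ≤ C * Real.exp (K * |z.im|) * 1 :=
          mul_le_mul (hgrowth z hz') (hwle z hz') (norm_nonneg _)
            ((norm_nonneg _).trans (hgrowth z hz'))
        _ ≤ |C| * Real.exp (|K| * Real.exp (1 * |z.im|)) := by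
          rw [mul_one]
          gcongr
          exact le_abs_self C
        _ = _ := by rw [Real.norm_of_nonneg (Real.exp_nonneg _)]
    · intro z hz
      have e : z = z.im * Complex.I := by apply Complex.ext <;> simp [hz]
      refine hbd z ?_ ?_
      · rw [hz, ← Real.cos_neg]; congr 1; ring
      · have := h₀ z.im
        rwa [← e] at this
    · intro z hz
      have e : z = 1 + z.im * Complex.I := by apply Complex.ext <;> simp [hz]
      refine hbd z ?_ ?_
      · rw [hz]; congr 1; ring
      · have := h₁ z.im
        rwa [← e] at this
    · simpa using hθ.1
    · simpa using hθ.2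
  have hwθ : Real.exp (-B) ≤ ‖w θ‖ := by
    rw [hnorm, Real.exp_le_exp]
    have h1 := Real.cos_le_one (k * (θ - 1 / 2))
    simp only [Complex.ofReal_re, Complex.ofReal_im, mul_zero, Real.cosh_zero, mul_one]
    nlinarith
  have : ‖F θ‖ * Real.exp (-B) ≤ 1 := by
    rw [norm_mul] at key
    exact (mul_le_mul_of_nonneg_left hwθ (norm_nonneg _)).trans key
  rwa [Real.exp_neg, ← div_eq_mul_inv, div_le_one (Real.exp_pos _)] at this

/-! ### Powers of functions and Hölder's inequality -/

/-- If `|u| = |f|^s` on the support of `f`, with `s = p / r`, then `f ↦ u` maps the unit ball of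
`L^p` to that of `L^r`. For `p = ∞` the relation `s / p = 1 / r` does not determine `s`, which then
has to be one. -/
theorem eLpNorm_le_one_of_norm_eq_rpow {X : Type*} [MeasurableSpace X] {μ : Measure X}
    {f u : X → ℂ} {p r : ℝ≥0∞} (hp : p ≠ 0) (hr : r ≠ 0) {s : ℝ}
    (hs : s * p⁻¹.toReal = r⁻¹.toReal) (hs' : p = ∞ → s = 1)
    (h0 : ∀ x, f x = 0 → u x = 0) (hu : ∀ x, f x ≠ 0 → ‖u x‖ = ‖f x‖ ^ s)
    (hf : eLpNorm f p μ ≤ 1) : eLpNorm u r μ ≤ 1 := by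
  by_cases hpt : p = ∞
  · have hrt : r = ∞ := by
      have : r⁻¹.toReal = 0 := by rw [← hs, hpt]; simp
      rw [ENNReal.toReal_eq_zero_iff] at this
      simpa [hr] using this
    subst hpt hrt
    refine (eLpNorm_mono fun x => ?_).trans hf
    by_cases hx : f x = 0
    · simp [h0 x hx]
    · simp [hu x hx, hs' rfl]
  have hp0 : 0 < p.toReal := ENNReal.toReal_pos hp hpt
  by_cases hrt : r = ∞
  · subst hrt
    have hs0 : s = 0 := by
      simpa [ENNReal.toReal_inv, hp0.ne'] using hs
    refine eLpNormEssSup_le_of_ae_bound (C := 1) (Filter.Eventually.of_forall fun x => ?_)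
      |>.trans (by simp)
    by_cases hx : f x = 0
    · simp [h0 x hx]
    · simp [hu x hx, hs0]
  have hr0 : 0 < r.toReal := ENNReal.toReal_pos hr hrt
  rw [ENNReal.toReal_inv, ENNReal.toReal_inv] at hs
  have hsr : s * r.toReal = p.toReal := by field_simp at hs; linarith
  rw [eLpNorm_eq_lintegral_rpow_enorm_toReal hp hpt, one_div, ENNReal.rpow_inv_le_iff hp0,
    ENNReal.one_rpow] at hf
  rw [eLpNorm_eq_lintegral_rpow_enorm_toReal hr hrt, one_div, ENNReal.rpow_inv_le_iff hr0,
    ENNReal.one_rpow]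
  refine (lintegral_mono fun x => ?_).trans hf
  by_cases hx : f x = 0
  · simp [h0 x hx, hr0]
  · have hpos : 0 < ‖f x‖ := norm_pos_iff.2 hx
    simp only [← ofReal_norm]
    rw [hu x hx, ENNReal.ofReal_rpow_of_nonneg (by positivity) hr0.le,
      ENNReal.ofReal_rpow_of_nonneg (by positivity) hp0.le, ← Real.rpow_mul hpos.le, hsr]

theorem norm_integral_mul_le {Y : Type*} [MeasurableSpace Y] {ν : Measure Y} {h g : Y → ℂ}
    (hh : AEStronglyMeasurable h ν) (hg : AEStronglyMeasurable g ν) {q q' : ℝ≥0∞}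
    (hq : q.HolderConjugate q') {M : ℝ≥0} (hhM : eLpNorm h q ν ≤ M) (hg1 : eLpNorm g q' ν ≤ 1) :
    ‖∫ y, h y * g y ∂ν‖ ≤ M := by
  have : ‖∫ y, h y * g y ∂ν‖ₑ ≤ M := by
    refine (enorm_integral_le_lintegral_enorm _).trans ?_
    rw [← eLpNorm_one_eq_lintegral_enorm]
    have := hq
    calc eLpNorm (fun y => h y * g y) 1 ν ≤ eLpNorm h q ν * eLpNorm g q' ν :=
          eLpNorm_smul_le_mul_eLpNorm (f := g) (φ := h) hg hh
      _ ≤ M * 1 := by gcongr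
      _ = M := mul_one _
  rw [← ofReal_norm] at this
  exact ENNReal.ofReal_le_coe.1 this

/-! ### Recovering an `L^q` norm from pairings with simple functions -/

/-- A bound on the pairings of `h` with the simple functions in the unit ball of `L^r` extends to
all integrable `u` in the unit ball, up to a factor two: the approximations `s n` of `u` satisfy
`|s n| ≤ 2 |u|`, so their halves stay in the unit ball, for `r = ∞` too. -/
theorem norm_integral_mul_le_of_forall_simple {Y : Type*} [MeasurableSpace Y] {ν : Measure Y}
    {h u : Y → ℂ} {r : ℝ≥0∞} {M : ℝ} (hh : Measurable h)
    (H : ∀ g : integrableSimple ν, eLpNorm g.1 r ν ≤ 1 → ‖∫ y, h y * g.1 y ∂ν‖ ≤ M)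
    (hu : Measurable u) (hui : Integrable u ν) (hhu : Integrable (fun y => h y * u y) ν)
    (hu1 : eLpNorm u r ν ≤ 1) : ‖∫ y, h y * u y ∂ν‖ ≤ 2 * M := by
  let s : ℕ → SimpleFunc Y ℂ := fun n =>
    (2⁻¹ : ℂ) • SimpleFunc.approxOn u hu univ 0 (mem_univ _) n
  have hs : ∀ n y, ‖s n y‖ ≤ ‖u y‖ := by
    intro n y
    have := SimpleFunc.norm_approxOn_zero_le hu (mem_univ _) y n
    simp only [s, SimpleFunc.coe_smul, Pi.smul_apply, norm_smul, norm_inv, Complex.norm_two]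
    linarith
  have hsi : ∀ n, Integrable (s n) ν := fun n =>
    hui.mono (s n).measurable.aestronglyMeasurable (Filter.Eventually.of_forall (hs n))
  have hle : ∀ n, ‖∫ y, h y * s n y ∂ν‖ ≤ M := fun n =>
    H ⟨s n, hsi n⟩ ((eLpNorm_mono (hs n)).trans hu1)
  have hlim : Filter.Tendsto (fun n => ∫ y, h y * s n y ∂ν) Filter.atTop
      (nhds (∫ y, h y * (2⁻¹ * u y) ∂ν)) := by
    refine tendsto_integral_of_dominated_convergence (fun y => ‖h y * u y‖)
      (fun n => (hh.mul (s n).measurable).aestronglyMeasurable) hhu.norm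
      (fun n => Filter.Eventually.of_forall fun y => ?_)
      (Filter.Eventually.of_forall fun y => ?_)
    · rw [norm_mul, norm_mul]
      exact mul_le_mul_of_nonneg_left (hs n y) (norm_nonneg _)
    · refine Filter.Tendsto.const_mul _ ?_
      exact (SimpleFunc.tendsto_approxOn hu (mem_univ _) (by simp)).const_mul _
  have h1 := le_of_tendsto hlim.norm (Filter.Eventually.of_forall hle)
  have h2 : ∫ y, h y * (2⁻¹ * u y) ∂ν = 2⁻¹ * ∫ y, h y * u y ∂ν := by
    rw [← integral_const_mul]
    congr 1; ext y; ring
  rw [h2, norm_mul, norm_inv, Complex.norm_two] at h1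
  linarith

/-- For `q < ∞`, the truncation of `h` to a set of finite measure on which `h` is bounded has finite
norm, and is tested against the extremal function of Hölder's inequality. -/
theorem eLpNorm_indicator_le_of_forall_simple {Y : Type*} [MeasurableSpace Y] {ν : Measure Y}
    {h : Y → ℂ} {q r : ℝ≥0∞} (hq : 1 ≤ q) (hqt : q ≠ ∞) (hqr : q.HolderConjugate r)
    {M : ℝ} (hh : Measurable h)
    (H : ∀ g : integrableSimple ν, eLpNorm g.1 r ν ≤ 1 → ‖∫ y, h y * g.1 y ∂ν‖ ≤ M)
    {A : Set Y} (hA : MeasurableSet A) (hAν : ν A ≠ ∞) {b : ℝ} (hb : ∀ y ∈ A, ‖h y‖ ≤ b) :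
    eLpNorm (A.indicator h) q ν ≤ ENNReal.ofReal (2 * M) := by
  have hq0 : q ≠ 0 := (zero_lt_one.trans_le hq).ne'
  have hq1 : 1 ≤ q.toReal := by
    simpa using ENNReal.toReal_mono hqt hq
  have hmem : MemLp (A.indicator h) q ν := by
    refine (memLp_indicator_iff_restrict hA).2 ?_
    have : IsFiniteMeasure (ν.restrict A) := ⟨by simpa using hAν.lt_top⟩
    exact MemLp.of_bound hh.aestronglyMeasurable b ((ae_restrict_iff' hA).2
      (Filter.Eventually.of_forall hb))
  set N : ℝ := (eLpNorm (A.indicator h) q ν).toReal with hN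
  have hNe : eLpNorm (A.indicator h) q ν = ENNReal.ofReal N :=
    (ENNReal.ofReal_toReal hmem.2.ne).symm
  rcases (ENNReal.toReal_nonneg (a := eLpNorm (A.indicator h) q ν)).eq_or_lt with h0 | hNpos
  · rw [hNe, hN, ← h0]; simp
  rw [← hN] at hNpos
  rw [hNe]
  refine ENNReal.ofReal_le_ofReal ?_
  set f : Y → ℂ := fun y => ((N⁻¹ : ℝ) : ℂ) • A.indicator h y with hf
  have hfm : Measurable f := (hh.indicator hA).const_smul ((N⁻¹ : ℝ) : ℂ)
  have hfmem : MemLp f q ν := hmem.const_smul ((N⁻¹ : ℝ) : ℂ)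
  have hf1 : eLpNorm f q ν = 1 := by
    have : eLpNorm f q ν = _ := eLpNorm_const_smul ((N⁻¹ : ℝ) : ℂ) (A.indicator h) q ν
    rw [this, hNe, ← ofReal_norm, ← ENNReal.ofReal_mul (norm_nonneg _), Complex.norm_real,
      Real.norm_of_nonneg (by positivity), inv_mul_cancel₀ hNpos.ne', ENNReal.ofReal_one]
  have hfint : ∫ y, ‖f y‖ ^ q.toReal ∂ν = 1 := by
    have h1 := hfmem.eLpNorm_eq_integral_rpow_norm hq0 hqt
    have h2 : 0 ≤ ∫ y, ‖f y‖ ^ q.toReal ∂ν := integral_nonneg fun y => by positivity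
    rw [hf1, eq_comm, ENNReal.ofReal_eq_one] at h1
    rw [← Real.rpow_inv_rpow h2 (by positivity : q.toReal ≠ 0), h1, Real.one_rpow]
  -- at the zeros of `f` the first factor makes `u` vanish, whatever the sign of `q - 2`
  set u : Y → ℂ := fun y => (starRingEnd ℂ) (f y) * ((‖f y‖ ^ (q.toReal - 2) : ℝ) : ℂ) with hu
  have hum : Measurable u := by
    refine (Complex.continuous_conj.measurable.comp hfm).mul
      (Complex.measurable_ofReal.comp (hfm.norm.pow_const _))
  have hu0 : ∀ y, f y = 0 → u y = 0 := fun y hy => by simp [hu, hy]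
  have hun : ∀ y, f y ≠ 0 → ‖u y‖ = ‖f y‖ ^ (q.toReal - 1) := by
    intro y hy
    have hpos := norm_pos_iff.2 hy
    calc ‖u y‖ = ‖f y‖ ^ (1 : ℝ) * ‖f y‖ ^ (q.toReal - 2) := by
          rw [hu, norm_mul, RCLike.norm_conj, Complex.norm_real,
            Real.norm_of_nonneg (by positivity), Real.rpow_one]
      _ = ‖f y‖ ^ (q.toReal - 1) := by rw [← Real.rpow_add hpos]; congr 1; ring
  have hfA : ∀ y, y ∉ A → f y = 0 := fun y hy => by simp [hf, hy]
  have hfh : ∀ y ∈ A, h y = N * f y := fun y hy => by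
    have : (N : ℂ) ≠ 0 := by exact_mod_cast hNpos.ne'
    simp [hf, hy, this]
  have hhu : ∀ y, h y * u y = N * ((‖f y‖ ^ q.toReal : ℝ) : ℂ) := by
    intro y
    by_cases hy : f y = 0
    · rw [hu0 y hy, hy, norm_zero, Real.zero_rpow (by positivity)]; simp
    have hyA : y ∈ A := by by_contra hyA; exact hy (hfA y hyA)
    have hpos := norm_pos_iff.2 hy
    rw [hfh y hyA, hu, mul_assoc, ← mul_assoc (f y), Complex.mul_conj, Complex.normSq_eq_norm_sq,
      ← Complex.ofReal_mul, ← Real.rpow_natCast, ← Real.rpow_add hpos]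
    congr 3; push_cast; ring
  have hui : Integrable u ν := by
    refine Integrable.mono' (g := A.indicator fun _ => (N⁻¹ * b) ^ (q.toReal - 1))
      ((integrable_indicator_iff hA).2 (integrableOn_const hAν)) hum.aestronglyMeasurable
      (Filter.Eventually.of_forall fun y => ?_)
    by_cases hyA : y ∈ A
    · have hb0 : 0 ≤ b := (norm_nonneg _).trans (hb y hyA)
      rw [indicator_of_mem hyA]
      by_cases hy : f y = 0
      · rw [hu0 y hy, norm_zero]; positivity
      · rw [hun y hy]
        refine Real.rpow_le_rpow (norm_nonneg _) ?_ (by linarith)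
        rw [hf, norm_smul, Complex.norm_real, Real.norm_of_nonneg (by positivity),
          indicator_of_mem hyA]
        exact mul_le_mul_of_nonneg_left (hb y hyA) (by positivity)
    · rw [indicator_of_notMem hyA, hu0 y (hfA y hyA), norm_zero]
  have hhui : Integrable (fun y => h y * u y) ν := by
    simp_rw [hhu]
    exact (hfmem.integrable_norm_rpow hq0 hqt).ofReal.const_mul _
  have hu1 : eLpNorm u r ν ≤ 1 := by
    have hr0 : r ≠ 0 := hqr.symm.ne_zero
    refine eLpNorm_le_one_of_norm_eq_rpow (f := f) (p := q) (s := q.toReal - 1) hq0 hr0 ?_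
      (fun h => absurd h hqt) hu0 hun hf1.le
    have h1 := hqr.inv_add_inv_eq_inv
    have h2 : q⁻¹.toReal + r⁻¹.toReal = 1 := by
      rw [← ENNReal.toReal_add (by simpa using hq0) (by simpa using hr0), h1]; simp
    rw [ENNReal.toReal_inv] at h2 ⊢
    field_simp at h2 ⊢
    linarith
  have := norm_integral_mul_le_of_forall_simple hh H hum hui hhui hu1
  simp_rw [hhu] at this
  rw [integral_const_mul, integral_complex_ofReal, hfint, norm_mul, Complex.norm_real,
    Real.norm_of_nonneg hNpos.le] at this
  simpa using this

/-- If `|h| > 2 M` on a set of positive measure, then `h` is tested against the normalized function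
`conj h / |h|` on a subset of finite positive measure. -/
theorem eLpNorm_top_le_of_forall_simple {Y : Type*} [MeasurableSpace Y] {ν : Measure Y}
    [SigmaFinite ν] {h : Y → ℂ} {M : ℝ} (hh : Measurable h)
    (hi : ∀ g : integrableSimple ν, Integrable (fun y => h y * g.1 y) ν)
    (H : ∀ g : integrableSimple ν, eLpNorm g.1 1 ν ≤ 1 → ‖∫ y, h y * g.1 y ∂ν‖ ≤ M) :
    eLpNorm h ∞ ν ≤ ENNReal.ofReal (2 * M) := by
  refine eLpNormEssSup_le_of_ae_bound (C := 2 * M) ?_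
  by_contra hcon
  have hSm : MeasurableSet {y | 2 * M < ‖h y‖} := measurableSet_lt measurable_const hh.norm
  have hpos : 0 < ν {y | 2 * M < ‖h y‖} := by
    refine pos_iff_ne_zero.2 fun h0 => hcon ?_
    rw [ae_iff]
    simpa using h0
  obtain ⟨B, hB, hBS, hB0, hBt⟩ := Measure.exists_subset_measure_lt_top hSm hpos
  set m : ℝ := ν.real B with hm
  have hmpos : 0 < m := ENNReal.toReal_pos hB0.ne' hBt.ne
  set u : Y → ℂ := B.indicator fun y => (starRingEnd ℂ) (h y) * ((‖h y‖ * m : ℝ) : ℂ)⁻¹ with hu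
  have hum : Measurable u := by
    refine Measurable.indicator ?_ hB
    exact (Complex.continuous_conj.measurable.comp hh).mul
      (Complex.measurable_ofReal.comp (hh.norm.mul_const _)).inv
  have hM : 0 ≤ M := (norm_nonneg _).trans (H 0 (by simp))
  have hne : ∀ y ∈ B, 0 < ‖h y‖ := fun y hy => lt_of_le_of_lt (by positivity) (hBS hy)
  have hun : ∀ y, ‖u y‖ = B.indicator (fun _ => m⁻¹) y := by
    intro y
    by_cases hy : y ∈ B
    · have := hne y hy
      rw [hu, indicator_of_mem hy, indicator_of_mem hy, norm_mul, RCLike.norm_conj, norm_inv,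
        Complex.norm_real, Real.norm_of_nonneg (by positivity)]
      field_simp
    · simp [hu, hy]
  have hInd : Integrable (B.indicator fun _ => m⁻¹) ν :=
    (integrable_indicator_iff hB).2 (integrableOn_const hBt.ne)
  have hui : Integrable u ν := hInd.mono' hum.aestronglyMeasurable
    (Filter.Eventually.of_forall fun y => (hun y).le)
  have hu1 : eLpNorm u 1 ν ≤ 1 := by
    rw [eLpNorm_one_eq_lintegral_enorm, ← ofReal_integral_norm_eq_lintegral_enorm hui]
    simp_rw [hun]
    rw [integral_indicator hB, setIntegral_const, smul_eq_mul, ← hm, mul_inv_cancel₀ hmpos.ne',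
      ENNReal.ofReal_one]
  have hhu : ∀ y, h y * u y = ((B.indicator (fun y => m⁻¹ * ‖h y‖) y : ℝ) : ℂ) := by
    intro y
    by_cases hy : y ∈ B
    · have := hne y hy
      rw [hu, indicator_of_mem hy, indicator_of_mem hy, ← mul_assoc, Complex.mul_conj,
        Complex.normSq_eq_norm_sq, ← Complex.ofReal_inv, ← Complex.ofReal_mul]
      congr 1
      field_simp
    · simp [hu, hy]
  have hhB : IntegrableOn h B ν := by
    classical
    have h1 : Integrable ((SimpleFunc.piecewise B hB (SimpleFunc.const Y (1 : ℂ)) 0 :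
        SimpleFunc Y ℂ)) ν := by
      rw [SimpleFunc.coe_piecewise, SimpleFunc.coe_const, SimpleFunc.coe_zero,
        piecewise_eq_indicator]
      exact (integrable_indicator_iff hB).2 (integrableOn_const hBt.ne)
    rw [← integrable_indicator_iff hB]
    refine (hi ⟨_, h1⟩).congr (Filter.Eventually.of_forall fun y => ?_)
    by_cases hy : y ∈ B <;> simp [hy]
  have hhBn : Integrable (B.indicator fun y => m⁻¹ * ‖h y‖) ν :=
    (integrable_indicator_iff hB).2 (hhB.norm.const_mul _)
  have hhui : Integrable (fun y => h y * u y) ν := by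
    simp_rw [hhu]
    exact hhBn.ofReal
  have key := norm_integral_mul_le_of_forall_simple hh H hum hui hhui hu1
  simp_rw [hhu] at key
  rw [integral_complex_ofReal, Complex.norm_real] at key
  -- the average of `‖h‖` over `B` exceeds `2 * M`
  have hlt : 0 < ∫ y in B, (‖h y‖ - 2 * M) ∂ν := by
    rw [setIntegral_pos_iff_support_of_nonneg_ae
      ((ae_restrict_iff' hB).2 (Filter.Eventually.of_forall fun y hy => sub_nonneg.2 (hBS hy).le))
      (hhB.norm.sub (integrableOn_const hBt.ne))]
    refine hB0.trans_le (measure_mono fun y hy => ⟨?_, hy⟩)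
    exact (sub_pos.2 (hBS hy)).ne'
  rw [integral_sub hhB.norm (integrableOn_const hBt.ne), setIntegral_const, smul_eq_mul, ← hm,
    sub_pos] at hlt
  rw [integral_indicator hB, integral_const_mul] at key
  have h2 := (le_abs_self _).trans key
  rw [inv_mul_le_iff₀ hmpos] at h2
  linarith

/-- A converse of Hölder's inequality, with a factor two: on a σ-finite space the `L^q` norm of `h`
is controlled by the pairings of `h` with the integrable simple functions in the unit ball of the
dual space. -/
theorem eLpNorm_le_of_forall_simple {Y : Type*} [MeasurableSpace Y] {ν : Measure Y}
    [SigmaFinite ν] {h : Y → ℂ} {q r : ℝ≥0∞} (hq : 1 ≤ q) (hqr : q.HolderConjugate r)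
    {M : ℝ} (hh : Measurable h)
    (hi : ∀ g : integrableSimple ν, Integrable (fun y => h y * g.1 y) ν)
    (H : ∀ g : integrableSimple ν, eLpNorm g.1 r ν ≤ 1 → ‖∫ y, h y * g.1 y ∂ν‖ ≤ M) :
    eLpNorm h q ν ≤ ENNReal.ofReal (2 * M) := by
  by_cases hqt : q = ∞
  · subst hqt
    have hr : r = 1 := by
      have := hqr.inv_add_inv_eq_inv
      simpa using this
    subst hr
    exact eLpNorm_top_le_of_forall_simple hh hi H
  set A : ℕ → Set Y := fun n => spanningSets ν n ∩ {y | ‖h y‖ ≤ n} with hA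
  have hAm : ∀ n, MeasurableSet (A n) := fun n =>
    (measurableSet_spanningSets ν n).inter (measurableSet_le hh.norm measurable_const)
  have hbd : ∀ n, eLpNorm ((A n).indicator h) q ν ≤ ENNReal.ofReal (2 * M) := fun n =>
    eLpNorm_indicator_le_of_forall_simple hq hqt hqr hh H (hAm n)
      ((measure_mono inter_subset_left).trans_lt (measure_spanningSets_lt_top ν n)).ne
      (b := n) (fun y hy => hy.2)
  refine (Lp.eLpNorm_lim_le_liminf_eLpNorm (f := fun n => (A n).indicator h)
    (fun n => (hh.indicator (hAm n)).aestronglyMeasurable) h ?_).trans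
    (Filter.liminf_le_of_le (by isBoundedDefault) fun b hb => ?_)
  · refine Filter.Eventually.of_forall fun y => tendsto_const_nhds.congr' ?_
    have hy : y ∈ ⋃ n, spanningSets ν n := by rw [iUnion_spanningSets]; trivial
    obtain ⟨n, hn⟩ := mem_iUnion.1 hy
    filter_upwards [Filter.eventually_ge_atTop (max n ⌈‖h y‖⌉₊)] with k hk
    have : y ∈ A k := ⟨monotone_spanningSets ν (le_of_max_le_left hk) hn,
      Nat.ceil_le.1 (le_of_max_le_right hk)⟩
    rw [indicator_of_mem this]
  · obtain ⟨n, hn⟩ := hb.exists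
    exact hn.trans (hbd n)

/-! ### Complex powers of simple functions -/

/-- The post-composition of an integrable simple function with a function fixing zero. -/
def integrableSimpleMap {X : Type*} [MeasurableSpace X] {μ : Measure X} (φ : ℂ → ℂ)
    (hφ : φ 0 = 0) (f : integrableSimple μ) : integrableSimple μ :=
  ⟨f.1.map φ, SimpleFunc.integrable_iff_finMeasSupp.2
    ((SimpleFunc.integrable_iff_finMeasSupp.1 f.2).map hφ)⟩

/-- The function `c ↦ |c|^γ c`, with value zero at `c = 0`. The exponent is shifted so that `γ = 0`
gives the identity, and the phase of `c` is kept. -/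
noncomputable def complexPower (γ c : ℂ) : ℂ := c * Complex.exp (γ * Real.log ‖c‖)

theorem complexPower_zero_right (γ : ℂ) : complexPower γ 0 = 0 := by simp [complexPower]

theorem complexPower_zero_left (c : ℂ) : complexPower 0 c = c := by simp [complexPower]

theorem norm_complexPower (γ : ℂ) {c : ℂ} (hc : c ≠ 0) :
    ‖complexPower γ c‖ = ‖c‖ ^ (1 + γ.re) := by
  have hpos := norm_pos_iff.2 hc
  rw [complexPower, norm_mul, Complex.norm_exp, Complex.re_mul_ofReal, Real.rpow_add hpos,
    Real.rpow_one, Real.rpow_def_of_pos hpos, mul_comm γ.re]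

theorem norm_complexPower_le {γ : ℂ} {K : ℝ} (hγ : |γ.re| ≤ K) (c : ℂ) :
    ‖complexPower γ c‖ ≤ ‖c‖ * Real.exp (K * |Real.log ‖c‖|) := by
  rw [complexPower, norm_mul, Complex.norm_exp, Complex.re_mul_ofReal]
  refine mul_le_mul_of_nonneg_left (Real.exp_le_exp.2 ?_) (norm_nonneg c)
  calc γ.re * Real.log ‖c‖ ≤ |γ.re * Real.log ‖c‖| := le_abs_self _
    _ = |γ.re| * |Real.log ‖c‖| := abs_mul _ _
    _ ≤ K * |Real.log ‖c‖| := by gcongr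

theorem differentiable_complexPower {γ : ℂ → ℂ} (hγ : Differentiable ℂ γ) (c : ℂ) :
    Differentiable ℂ fun z => complexPower (γ z) c := by
  unfold complexPower
  fun_prop

/-- The simple function `|f|^γ f`, zero where `f` is. -/
noncomputable def simplePower {X : Type*} [MeasurableSpace X] {μ : Measure X} (γ : ℂ)
    (f : integrableSimple μ) : integrableSimple μ :=
  integrableSimpleMap (complexPower γ) (complexPower_zero_right γ) f

theorem simplePower_apply {X : Type*} [MeasurableSpace X] {μ : Measure X} (γ : ℂ)
    (f : integrableSimple μ) (x : X) : (simplePower γ f).1 x = complexPower γ (f.1 x) := rfl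

theorem simplePower_zero {X : Type*} [MeasurableSpace X] {μ : Measure X}
    (f : integrableSimple μ) : simplePower 0 f = f := by
  ext x
  rw [simplePower_apply, complexPower_zero_left]

theorem eLpNorm_simplePower_le_one {X : Type*} [MeasurableSpace X] {μ : Measure X}
    {f : integrableSimple μ} {p r : ℝ≥0∞} (hp : p ≠ 0) (hr : r ≠ 0) {γ : ℂ}
    (hγ : (1 + γ.re) * p⁻¹.toReal = r⁻¹.toReal) (hγ' : p = ∞ → γ.re = 0)
    (hf : eLpNorm f.1 p μ ≤ 1) : eLpNorm (simplePower γ f).1 r μ ≤ 1 := by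
  refine eLpNorm_le_one_of_norm_eq_rpow hp hr hγ (fun h => by rw [hγ' h, add_zero])
    (fun x hx => ?_) (fun x hx => ?_) hf
  · rw [simplePower_apply, hx, complexPower_zero_right]
  · rw [simplePower_apply, norm_complexPower γ hx]

open Classical in
/-- The indicator function of the level set `{f = c}`, replaced by zero for `c = 0`, when the level
set may have infinite measure. -/
noncomputable def levelIndicator {X : Type*} [MeasurableSpace X] {μ : Measure X}
    (f : integrableSimple μ) (c : ℂ) : integrableSimple μ :=
  integrableSimpleMap (fun d => if d = c ∧ d ≠ 0 then 1 else 0) (by simp) f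

theorem simplePower_eq_sum {X : Type*} [MeasurableSpace X] {μ : Measure X} (γ : ℂ)
    (f : integrableSimple μ) :
    simplePower γ f = ∑ c ∈ f.1.range, complexPower γ c • levelIndicator f c := by
  ext x
  have hsum : ∀ s : Finset ℂ, (∑ c ∈ s, complexPower γ c • levelIndicator f c).1 x
      = ∑ c ∈ s, complexPower γ c * (levelIndicator f c).1 x := by
    intro s
    induction s using Finset.induction_on with
    | empty => simp
    | insert a s ha ih =>
      rw [Finset.sum_insert ha, Finset.sum_insert ha, ← ih]
      rfl
  rw [hsum, simplePower_apply, Finset.sum_eq_single (f.1 x)]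
  · by_cases hx : f.1 x = 0
    · simp [hx, complexPower_zero_right]
    · have : (levelIndicator f (f.1 x)).1 x = if f.1 x = f.1 x ∧ f.1 x ≠ 0 then 1 else 0 := rfl
      rw [this]; simp [hx]
  · intro c _ hc
    have : (levelIndicator f c).1 x = if f.1 x = c ∧ f.1 x ≠ 0 then 1 else 0 := rfl
    rw [this]; simp [hc.symm]
  · intro h
    exact absurd (SimpleFunc.mem_range_self _ _) h

/-! ### The pairing of an admissible family with powers of simple functions -/

section

variable {X Y : Type*} [MeasurableSpace X] [MeasurableSpace Y] {μ : Measure X} {ν : Measure Y}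
  {T : ℂ → (integrableSimple μ →ₗ[ℂ] (Y →ₘ[ν] ℂ))}

/-- The pairing is bilinear; integrability of the products is needed for this. -/
theorem IsAdmissibleFamily.stripPairing_sum (hT : IsAdmissibleFamily T) {z : ℂ}
    (hz : z ∈ closedStrip) {ι κ : Type*} (s : Finset ι) (t : Finset κ) (a : ι → ℂ) (b : κ → ℂ)
    (f : ι → integrableSimple μ) (g : κ → integrableSimple ν) :
    stripPairing T (∑ i ∈ s, a i • f i) (∑ j ∈ t, b j • g j) z
      = ∑ i ∈ s, ∑ j ∈ t, a i * b j * stripPairing T (f i) (g j) z := by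
  let L : integrableSimple μ →ₗ[ℂ] integrableSimple ν →ₗ[ℂ] ℂ :=
    LinearMap.mk₂ ℂ (fun f g => stripPairing T f g z)
      (fun f₁ f₂ g => by
        unfold stripPairing
        rw [← integral_add (hT.integrable z hz f₁ g) (hT.integrable z hz f₂ g), map_add]
        refine integral_congr_ae ?_
        filter_upwards [AEEqFun.coeFn_add (T z f₁) (T z f₂)] with y hy
        rw [hy, Pi.add_apply, add_mul])
      (fun c f g => by
        unfold stripPairing
        rw [smul_eq_mul, ← integral_const_mul, map_smul]
        refine integral_congr_ae ?_
        filter_upwards [AEEqFun.coeFn_smul c (T z f)] with y hy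
        rw [hy, Pi.smul_apply, smul_eq_mul, mul_assoc])
      (fun f g₁ g₂ => by
        unfold stripPairing
        rw [← integral_add (hT.integrable z hz f g₁) (hT.integrable z hz f g₂)]
        refine integral_congr_ae (Filter.Eventually.of_forall fun y => ?_)
        exact mul_add _ _ _)
      (fun c f g => by
        unfold stripPairing
        rw [smul_eq_mul, ← integral_const_mul]
        refine integral_congr_ae (Filter.Eventually.of_forall fun y => ?_)
        exact mul_left_comm _ _ _)
  have : stripPairing T (∑ i ∈ s, a i • f i) (∑ j ∈ t, b j • g j) z
      = L (∑ i ∈ s, a i • f i) (∑ j ∈ t, b j • g j) := rfl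
  rw [this]
  simp only [map_sum, map_smul, LinearMap.sum_apply, LinearMap.smul_apply, smul_eq_mul,
    Finset.mul_sum]
  rw [Finset.sum_comm]
  exact Finset.sum_congr rfl fun i _ => Finset.sum_congr rfl fun j _ => by
    simp only [L, LinearMap.mk₂_apply]; ring

theorem IsAdmissibleFamily.exists_norm_stripPairing_le (hT : IsAdmissibleFamily T)
    (f : integrableSimple μ) (g : integrableSimple ν) :
    ∃ C : ℝ, 0 ≤ C ∧
      ∀ z ∈ closedStrip, ‖stripPairing T f g z‖ ≤ C * Real.exp (Real.pi * |z.im|) := by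
  obtain ⟨k, hk, C, hC⟩ := hT.growth f g
  refine ⟨|C|, abs_nonneg C, fun z hz => ?_⟩
  have h1 : Real.exp (-k * |z.im|) * ‖stripPairing T f g z‖ ≤ C := hC ⟨z, hz, rfl⟩
  rw [neg_mul, Real.exp_neg, inv_mul_le_iff₀ (Real.exp_pos _), mul_comm] at h1
  refine h1.trans ?_
  gcongr
  exact le_abs_self C

/-- The affine function of `z` with value `a` at `0` and `b` at `1`. -/
noncomputable def interpExponent (a b : ℝ) (z : ℂ) : ℂ := a * (1 - z) + b * z

theorem differentiable_interpExponent (a b : ℝ) : Differentiable ℂ (interpExponent a b) := by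
  unfold interpExponent
  fun_prop

theorem re_interpExponent (a b : ℝ) (z : ℂ) :
    (interpExponent a b z).re = a * (1 - z.re) + b * z.re := by
  simp [interpExponent]

theorem abs_re_interpExponent_le (a b : ℝ) {z : ℂ} (hz : z ∈ closedStrip) :
    |(interpExponent a b z).re| ≤ |a| + |b| := by
  obtain ⟨h0, h1⟩ := hz
  rw [re_interpExponent]
  refine (abs_add_le _ _).trans ?_
  rw [abs_mul, abs_mul, abs_of_nonneg h0, abs_of_nonneg (sub_nonneg.2 h1)]
  have := abs_nonneg a
  have := abs_nonneg b
  gcongr <;> nlinarith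

/-- The pairing of `T_z |f|^{γ(z)} f` with `|g|^{δ(z)} g`, for affine `γ` and `δ`, inherits
holomorphy, continuity and exponential growth from the pairings of the level sets of `f` and `g`. -/
theorem IsAdmissibleFamily.powerPairing_regularity (hT : IsAdmissibleFamily T)
    (f : integrableSimple μ) (g : integrableSimple ν) (a b a' b' : ℝ) :
    let F : ℂ → ℂ := fun z =>
      stripPairing T (simplePower (interpExponent a b z) f)
        (simplePower (interpExponent a' b' z) g) z
    DifferentiableOn ℂ F (interior closedStrip) ∧ ContinuousOn F closedStrip ∧
      ∃ C : ℝ, ∀ z ∈ closedStrip, ‖F z‖ ≤ C * Real.exp (Real.pi * |z.im|) := by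
  intro F
  have hF : EqOn F (fun z => ∑ c ∈ f.1.range, ∑ d ∈ g.1.range,
      complexPower (interpExponent a b z) c * complexPower (interpExponent a' b' z) d
        * stripPairing T (levelIndicator f c) (levelIndicator g d) z) closedStrip := by
    intro z hz
    simp only [F]
    rw [simplePower_eq_sum, simplePower_eq_sum, hT.stripPairing_sum hz]
  have hd : ∀ (a b : ℝ) (c : ℂ), Differentiable ℂ fun z => complexPower (interpExponent a b z) c :=
    fun a b c => differentiable_complexPower (differentiable_interpExponent a b) c
  refine ⟨?_, ?_, ?_⟩
  · refine DifferentiableOn.congr ?_ (hF.mono interior_subset)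
    refine DifferentiableOn.fun_sum fun c _ => DifferentiableOn.fun_sum fun d _ => ?_
    exact ((hd _ _ _).mul (hd _ _ _)).differentiableOn.mul (hT.differentiableOn _ _)
  · refine ContinuousOn.congr ?_ hF
    refine continuousOn_finsetSum _ fun c _ => continuousOn_finsetSum _ fun d _ => ?_
    exact ((hd _ _ _).mul (hd _ _ _)).continuous.continuousOn.mul (hT.continuousOn _ _)
  · choose C hC0 hC using fun c d => hT.exists_norm_stripPairing_le
      (levelIndicator f c) (levelIndicator g d)
    refine ⟨∑ c ∈ f.1.range, ∑ d ∈ g.1.range,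
      (‖c‖ * Real.exp ((|a| + |b|) * |Real.log ‖c‖|)) *
      (‖d‖ * Real.exp ((|a'| + |b'|) * |Real.log ‖d‖|)) * C c d, fun z hz => ?_⟩
    rw [hF hz, Finset.sum_mul]
    refine norm_sum_le_of_le _ fun c _ => ?_
    rw [Finset.sum_mul]
    refine norm_sum_le_of_le _ fun d _ => ?_
    rw [norm_mul, norm_mul, mul_assoc _ (C c d)]
    gcongr
    · exact norm_complexPower_le (abs_re_interpExponent_le a b hz) c
    · exact norm_complexPower_le (abs_re_interpExponent_le a' b' hz) d
    · exact hC c d z hz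

/-! ### The exponents and the constants -/

/-- The exponent `k` can be enlarged to be positive, and the two bounds can be given the same
nonnegative constant. Where `M_j` vanishes, `Real.log` carries no information and none is needed. -/
theorem exists_exp_exp_bound {M₀ M₁ : ℝ → ℝ≥0}
    (hlog : ∃ k : ℝ, k < Real.pi ∧
      BddAbove (range fun y : ℝ => Real.exp (-k * |y|) * Real.log (M₀ y)) ∧
      BddAbove (range fun y : ℝ => Real.exp (-k * |y|) * Real.log (M₁ y))) :
    ∃ k A : ℝ, 0 < k ∧ k < Real.pi ∧ 0 ≤ A ∧
      (∀ y, (M₀ y : ℝ) ≤ Real.exp (A * Real.exp (k * |y|))) ∧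
      ∀ y, (M₁ y : ℝ) ≤ Real.exp (A * Real.exp (k * |y|)) := by
  obtain ⟨k, hk, ⟨A₀, hA₀⟩, ⟨A₁, hA₁⟩⟩ := hlog
  have aux : ∀ (M : ℝ → ℝ≥0) (B : ℝ),
      B ∈ upperBounds (range fun y : ℝ => Real.exp (-k * |y|) * Real.log (M y)) →
      B ≤ |A₀| + |A₁| →
      ∀ y, (M y : ℝ) ≤ Real.exp ((|A₀| + |A₁|) * Real.exp (max k 1 * |y|)) := by
    intro M B hB hBA y
    rcases (M y).coe_nonneg.eq_or_lt with h | h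
    · rw [← h]; positivity
    rw [← Real.exp_log h, Real.exp_le_exp]
    have h1 : Real.exp (-k * |y|) * Real.log (M y) ≤ B := hB ⟨y, rfl⟩
    rw [neg_mul, Real.exp_neg, inv_mul_le_iff₀ (Real.exp_pos _), mul_comm] at h1
    refine h1.trans ?_
    gcongr
    exact le_max_left k 1
  refine ⟨max k 1, |A₀| + |A₁|, by positivity, max_lt hk (by linarith [Real.pi_gt_three]),
    by positivity, aux M₀ A₀ hA₀ ?_, aux M₁ A₁ hA₁ ?_⟩
  · linarith [le_abs_self A₀, abs_nonneg A₁]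
  · linarith [le_abs_self A₁, abs_nonneg A₀]

/-- The affine exponent `γ`, vanishing at `θ`, for which raising to the power `1 + γ` turns the
reciprocal exponent `a = 1 / p` into `a₀ = 1 / p₀` at `0` and into `a₁ = 1 / p₁` at `1`.
If `a = 0`, all three vanish and no power has to be taken. -/
theorem exists_interpExponent {θ : ℝ} (hθ : θ ∈ Ioo (0 : ℝ) 1) {a₀ a₁ a : ℝ} (ha₀ : 0 ≤ a₀)
    (ha₁ : 0 ≤ a₁) (ha : a = (1 - θ) * a₀ + θ * a₁) :
    ∃ γ₀ γ₁ : ℝ, (1 + γ₀) * a = a₀ ∧ (1 + γ₁) * a = a₁ ∧ (a = 0 → γ₀ = 0 ∧ γ₁ = 0) ∧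
      interpExponent γ₀ γ₁ θ = 0 := by
  obtain ⟨h0, h1⟩ := hθ
  by_cases h : a = 0
  · have h2 : a₀ = 0 := by nlinarith [mul_nonneg h0.le ha₁]
    have h3 : a₁ = 0 := by nlinarith [mul_nonneg (sub_nonneg.2 h1.le) ha₀]
    exact ⟨0, 0, by simp [h, h2], by simp [h, h3], fun _ => ⟨rfl, rfl⟩, by simp [interpExponent]⟩
  · refine ⟨a₀ / a - 1, a₁ / a - 1, by field_simp; ring, by field_simp; ring,
      fun h' => absurd h' h, ?_⟩
    have : (a₀ / a - 1) * (1 - θ) + (a₁ / a - 1) * θ = 0 := by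
      field_simp
      rw [ha]; ring
    unfold interpExponent
    exact_mod_cast this

end

/-! ### Interpolation -/

/-- A linear operator that maps the unit ball of `L^p` to the ball of radius `C` of `L^q` is bounded
with constant `C`; functions of norm zero are covered, by scaling with arbitrarily small `t`. -/
theorem eLpNorm_le_mul_of_forall_le_one {X Y : Type*} [MeasurableSpace X] [MeasurableSpace Y]
    {μ : Measure X} {ν : Measure Y} (S : integrableSimple μ →ₗ[ℂ] (Y →ₘ[ν] ℂ)) {p q : ℝ≥0∞}
    {C : ℝ≥0} (hC : C ≠ 0) (H : ∀ f : integrableSimple μ, eLpNorm f.1 p μ ≤ 1 →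
      eLpNorm (S f) q ν ≤ C) (f : integrableSimple μ) :
    eLpNorm (S f) q ν ≤ C * eLpNorm f.1 p μ := by
  have hC' : (C : ℝ≥0∞) ≠ 0 := by exact_mod_cast hC
  rw [mul_comm, ← ENNReal.div_le_iff_le_mul (.inl hC') (.inl ENNReal.coe_ne_top)]
  refine le_of_forall_gt_imp_ge_of_dense fun t ht => ?_
  rcases eq_or_ne t ∞ with rfl | htt
  · exact le_top
  lift t to ℝ≥0 using htt
  have ht0 : t ≠ 0 := by
    rintro rfl
    exact absurd ht (by simp)
  have ht0' : (t : ℝ≥0∞) ≠ 0 := by exact_mod_cast ht0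
  rw [ENNReal.div_le_iff_le_mul (.inl hC') (.inl ENNReal.coe_ne_top)]
  have hnorm : ‖(((t⁻¹ : ℝ≥0) : ℝ) : ℂ)‖ₑ = (t : ℝ≥0∞)⁻¹ := by
    rw [← ofReal_norm, Complex.norm_real, NNReal.norm_eq, ENNReal.ofReal_coe_nnreal,
      ENNReal.coe_inv ht0]
  have h1 : eLpNorm (S ((((t⁻¹ : ℝ≥0) : ℝ) : ℂ) • f)) q ν ≤ C := by
    refine H _ ?_
    have : eLpNorm (((((t⁻¹ : ℝ≥0) : ℝ) : ℂ) • f : integrableSimple μ).1 : X → ℂ) p μ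
        = ‖(((t⁻¹ : ℝ≥0) : ℝ) : ℂ)‖ₑ * eLpNorm f.1 p μ := eLpNorm_const_smul _ _ _ _
    rw [this, hnorm, ← ENNReal.inv_mul_cancel ht0' ENNReal.coe_ne_top]
    gcongr
  rw [map_smul, eLpNorm_congr_ae (AEEqFun.coeFn_smul _ _), eLpNorm_const_smul, hnorm] at h1
  calc eLpNorm (S f) q ν = t * ((t : ℝ≥0∞)⁻¹ * eLpNorm (S f) q ν) := by
        rw [← mul_assoc, ENNReal.mul_inv_cancel ht0' ENNReal.coe_ne_top, one_mul]
    _ ≤ t * C := by gcongr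

theorem toReal_inv_convexCombination {θ : ℝ} (hθ : θ ∈ Icc (0 : ℝ) 1) {p₀ p₁ p : ℝ≥0∞}
    (hp₀ : 1 ≤ p₀) (hp₁ : 1 ≤ p₁)
    (hp : p⁻¹ = ENNReal.ofReal (1 - θ) * p₀⁻¹ + ENNReal.ofReal θ * p₁⁻¹) :
    1 ≤ p ∧ p⁻¹.toReal = (1 - θ) * p₀⁻¹.toReal + θ * p₁⁻¹.toReal := by
  have h0 : p₀⁻¹ ≤ 1 := ENNReal.inv_le_one.2 hp₀
  have h1 : p₁⁻¹ ≤ 1 := ENNReal.inv_le_one.2 hp₁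
  refine ⟨?_, ?_⟩
  · rw [← ENNReal.inv_le_one, hp]
    calc _ ≤ ENNReal.ofReal (1 - θ) * 1 + ENNReal.ofReal θ * 1 := by gcongr
      _ = 1 := by
        rw [mul_one, mul_one, ← ENNReal.ofReal_add (sub_nonneg.2 hθ.2) hθ.1, sub_add_cancel,
          ENNReal.ofReal_one]
  · have t0 := (h0.trans_lt ENNReal.one_lt_top).ne
    have t1 := (h1.trans_lt ENNReal.one_lt_top).ne
    rw [hp, ENNReal.toReal_add (ENNReal.mul_ne_top ENNReal.ofReal_ne_top t0)
      (ENNReal.mul_ne_top ENNReal.ofReal_ne_top t1), ENNReal.toReal_mul, ENNReal.toReal_mul,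
      ENNReal.toReal_ofReal (sub_nonneg.2 hθ.2), ENNReal.toReal_ofReal hθ.1]

theorem toReal_inv_conjugate {q : ℝ≥0∞} (hq : 1 ≤ q) :
    ((1 - q⁻¹)⁻¹)⁻¹.toReal = 1 - q⁻¹.toReal := by
  rw [inv_inv, ENNReal.toReal_sub_of_le (ENNReal.inv_le_one.2 hq) ENNReal.one_ne_top,
    ENNReal.toReal_one]

/-- Interpolation at an interior point of the strip, on the unit ball of `L^p`. -/
theorem IsAdmissibleFamily.eLpNorm_le_of_mem_Ioo {X Y : Type*} [MeasurableSpace X]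
    [MeasurableSpace Y] {μ : Measure X} {ν : Measure Y} [SigmaFinite ν]
    {T : ℂ → (integrableSimple μ →ₗ[ℂ] (Y →ₘ[ν] ℂ))} (hT : IsAdmissibleFamily T)
    {p₀ p₁ q₀ q₁ : ℝ≥0∞} (hp₀ : 1 ≤ p₀) (hp₁ : 1 ≤ p₁) (hq₀ : 1 ≤ q₀) (hq₁ : 1 ≤ q₁)
    {M₀ M₁ : ℝ → ℝ≥0}
    (hM₀ : ∀ (y : ℝ) (f : integrableSimple μ),
      eLpNorm (T (y * Complex.I) f) q₀ ν ≤ M₀ y * eLpNorm f.1 p₀ μ)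
    (hM₁ : ∀ (y : ℝ) (f : integrableSimple μ),
      eLpNorm (T (1 + y * Complex.I) f) q₁ ν ≤ M₁ y * eLpNorm f.1 p₁ μ)
    {k A : ℝ} (hk : 0 < k) (hkπ : k < Real.pi) (hA : 0 ≤ A)
    (hA₀ : ∀ y, (M₀ y : ℝ) ≤ Real.exp (A * Real.exp (k * |y|)))
    (hA₁ : ∀ y, (M₁ y : ℝ) ≤ Real.exp (A * Real.exp (k * |y|)))
    {θ : ℝ} (hθ : θ ∈ Ioo (0 : ℝ) 1) {p q : ℝ≥0∞}
    (hp : p⁻¹ = ENNReal.ofReal (1 - θ) * p₀⁻¹ + ENNReal.ofReal θ * p₁⁻¹)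
    (hq : q⁻¹ = ENNReal.ofReal (1 - θ) * q₀⁻¹ + ENNReal.ofReal θ * q₁⁻¹)
    {f : integrableSimple μ} (hf : eLpNorm f.1 p μ ≤ 1) :
    eLpNorm (T θ f) q ν ≤ ENNReal.ofReal (2 * Real.exp (2 * A / Real.cos (k / 2))) := by
  have hθ' := Ioo_subset_Icc_self hθ
  obtain ⟨hp1, hpr⟩ := toReal_inv_convexCombination hθ' hp₀ hp₁ hp
  obtain ⟨hq1, hqr⟩ := toReal_inv_convexCombination hθ' hq₀ hq₁ hq
  have conj : ∀ {q : ℝ≥0∞}, 1 ≤ q → q.HolderConjugate (1 - q⁻¹)⁻¹ :=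
    fun h => ENNReal.HolderConjugate.inv_one_sub_inv' h
  have conj0 : ∀ {q : ℝ≥0∞}, (1 - q⁻¹)⁻¹ ≠ 0 := fun {q} => by
    rw [ne_eq, ENNReal.inv_eq_zero]
    exact (tsub_le_self.trans_lt ENNReal.one_lt_top).ne
  have hne : ∀ {p : ℝ≥0∞}, 1 ≤ p → p ≠ 0 := fun h => (zero_lt_one.trans_le h).ne'
  obtain ⟨γ₀, γ₁, hγ₀, hγ₁, hγ, hγθ⟩ := exists_interpExponent hθ
    (ENNReal.toReal_nonneg (a := p₀⁻¹)) (ENNReal.toReal_nonneg (a := p₁⁻¹)) hpr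
  obtain ⟨δ₀, δ₁, hδ₀, hδ₁, hδ, hδθ⟩ := exists_interpExponent hθ
    (ENNReal.toReal_nonneg (a := ((1 - q₀⁻¹)⁻¹)⁻¹))
    (ENNReal.toReal_nonneg (a := ((1 - q₁⁻¹)⁻¹)⁻¹))
    (a := ((1 - q⁻¹)⁻¹)⁻¹.toReal) (by
      rw [toReal_inv_conjugate hq1, toReal_inv_conjugate hq₀, toReal_inv_conjugate hq₁, hqr]; ring)
  refine eLpNorm_le_of_forall_simple hq1 (conj hq1) (T θ f).stronglyMeasurable.measurable
    (hT.integrable θ (by simpa [closedStrip] using hθ') f) fun g hg => ?_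
  obtain ⟨hFd, hFc, C, hFC⟩ := hT.powerPairing_regularity f g γ₀ γ₁ δ₀ δ₁
  have key := norm_le_of_strip_of_boundary_exp_exp hk hkπ hA hFd hFc hFC ?_ ?_ hθ'
  · simp only [hγθ, hδθ, simplePower_zero] at key
    exact key
  · intro y
    refine le_trans ?_ (hA₀ y)
    have re₀ : ∀ a b : ℝ, (interpExponent a b (y * Complex.I)).re = a := by
      intro a b; simp [re_interpExponent]
    refine norm_integral_mul_le (AEEqFun.aestronglyMeasurable _)
      (SimpleFunc.measurable _).aestronglyMeasurable (conj hq₀)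
      ((hM₀ y _).trans (mul_le_of_le_one_right' ?_)) ?_
    · refine eLpNorm_simplePower_le_one (hne hp1) (hne hp₀) ?_ (fun h => ?_) hf
      · rw [re₀, hγ₀]
      · rw [re₀]; exact (hγ (by simp [h])).1
    · refine eLpNorm_simplePower_le_one conj0 conj0 ?_ (fun h => ?_) hg
      · rw [re₀, hδ₀]
      · rw [re₀]; exact (hδ (by simp [h])).1
  · intro y
    refine le_trans ?_ (hA₁ y)
    have re₁ : ∀ a b : ℝ, (interpExponent a b (1 + y * Complex.I)).re = b := by
      intro a b; simp [re_interpExponent]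
    refine norm_integral_mul_le (AEEqFun.aestronglyMeasurable _)
      (SimpleFunc.measurable _).aestronglyMeasurable (conj hq₁)
      ((hM₁ y _).trans (mul_le_of_le_one_right' ?_)) ?_
    · refine eLpNorm_simplePower_le_one (hne hp1) (hne hp₁) ?_ (fun h => ?_) hf
      · rw [re₁, hγ₁]
      · rw [re₁]; exact (hγ (by simp [h])).2
    · refine eLpNorm_simplePower_le_one conj0 conj0 ?_ (fun h => ?_) hg
      · rw [re₁, hδ₁]
      · rw [re₁]; exact (hδ (by simp [h])).2

theorem mainTheorem2 {X Y : Type*} [MeasurableSpace X] [MeasurableSpace Y]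
    (μ : Measure X) (ν : Measure Y) [SigmaFinite μ] [SigmaFinite ν]
    (T : ℂ → (integrableSimple μ →ₗ[ℂ] (Y →ₘ[ν] ℂ))) (hT : IsAdmissibleFamily T)
    (p₀ p₁ q₀ q₁ : ℝ≥0∞) (hp₀ : 1 ≤ p₀) (hp₁ : 1 ≤ p₁) (hq₀ : 1 ≤ q₀) (hq₁ : 1 ≤ q₁)
    (M₀ M₁ : ℝ → ℝ≥0)
    (hM₀ : ∀ (y : ℝ) (f : integrableSimple μ),
      eLpNorm (T (y * Complex.I) f) q₀ ν ≤ M₀ y * eLpNorm f.1 p₀ μ)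
    (hM₁ : ∀ (y : ℝ) (f : integrableSimple μ),
      eLpNorm (T (1 + y * Complex.I) f) q₁ ν ≤ M₁ y * eLpNorm f.1 p₁ μ)
    (hlog : ∃ k : ℝ, k < Real.pi ∧
      BddAbove (range fun y : ℝ => Real.exp (-k * |y|) * Real.log (M₀ y)) ∧
      BddAbove (range fun y : ℝ => Real.exp (-k * |y|) * Real.log (M₁ y)))
    (θ : ℝ) (hθ : θ ∈ Icc (0 : ℝ) 1) (p q : ℝ≥0∞)
    (hp : p⁻¹ = ENNReal.ofReal (1 - θ) * p₀⁻¹ + ENNReal.ofReal θ * p₁⁻¹)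
    (hq : q⁻¹ = ENNReal.ofReal (1 - θ) * q₀⁻¹ + ENNReal.ofReal θ * q₁⁻¹) :
    ∃ M : ℝ≥0, ∀ f : integrableSimple μ,
      eLpNorm (T (θ : ℂ) f) q ν ≤ M * eLpNorm f.1 p μ := by
  rcases hθ.1.eq_or_lt with rfl | h0
  · obtain rfl : p = p₀ := by simpa using hp
    obtain rfl : q = q₀ := by simpa using hq
    exact ⟨M₀ 0, fun f => by simpa using hM₀ 0 f⟩
  rcases hθ.2.eq_or_lt with rfl | h1
  · obtain rfl : p = p₁ := by simpa using hp
    obtain rfl : q = q₁ := by simpa using hq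
    exact ⟨M₁ 0, fun f => by simpa using hM₁ 0 f⟩
  obtain ⟨k, A, hk, hkπ, hA, hA₀, hA₁⟩ := exists_exp_exp_bound hlog
  exact ⟨Real.toNNReal (2 * Real.exp (2 * A / Real.cos (k / 2))), fun f =>
    eLpNorm_le_mul_of_forall_le_one (T θ) (Real.toNNReal_pos.2 (by positivity)).ne'
      (fun f hf => hT.eLpNorm_le_of_mem_Ioo hp₀ hp₁ hq₀ hq₁ hM₀ hM₁ hk hkπ hA hA₀ hA₁
        ⟨h0, h1⟩ hp hq hf) f⟩
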